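/- All graphs are finite and simple. For $k\ge 1$, a graph is $k$-connected if it has more than $k$ vertices and deleting any set of fewer than $k$ vertices leaves a connected graph. Let $r,m$ be integers with $1\le r\le m-3$, and let $PS(r,m-r)$ be the path-star: the graph of order $m$ obtained from the disjoint union of a path of order $r+1$ and a star of order $m-r$ (one center adjacent to $m-r-1$ leaves) by identifying one end vertex of the path with one leaf of the star. Then every $2$-connected graph $G$ with minimum degree $\delta(G)\ge m+2$ contains a (not necessarily induced) subgraph $T$ isomorphic to $PS(r,m-r)$ such that $G-V(T)$, the subgraph of $G$ induced by the vertices outside $T$, is $2$-connected. -/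

import Mathlib

namespace PathStarKeeping

/-- `G` is `k`-connected (vertex connectivity at least `k`): it has more than `k` vertices, and
deleting any set of fewer than `k` vertices leaves a connected graph. -/
def IsVertexConnected {V : Type*} (k : ℕ) (G : SimpleGraph V) : Prop :=
  (k : ℕ∞) < ENat.card V ∧
    ∀ S : Finset V, S.card < k → (G.induce ((S : Set V)ᶜ)).Connected

/-- The path-star `PS(r, s)` (for `2 ≤ s`), on the vertices `0, …, r + s - 1`.
The first clause is the path `0, 1, …, r` of order `r + 1`; the second clause is the star of
order `s` with center `r + 1` and leaves `r, r + 2, …, r + s - 1`. They share exactly the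
vertex `r`, which is an end of the path and a leaf of the star. (`fromRel` makes the relation
symmetric and removes loops.) -/
def pathStar (r s : ℕ) : SimpleGraph (Fin (r + s)) :=
  SimpleGraph.fromRel fun i j =>
    ((j : ℕ) = (i : ℕ) + 1 ∧ (j : ℕ) ≤ r) ∨ ((i : ℕ) = r + 1 ∧ r ≤ (j : ℕ))

end PathStarKeeping

/-! Among the biconnected sets (a single edge counts) whose complement still contains a path-star,
stored as a broom with centre `a`, take a largest one, `B`. The broom then fills the complement
(`mem_broom_of_maximal`), so deleting it leaves exactly `B`. The lever is that adding an ear keeps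
`B` biconnected (`IsBiconnectedSet.union_ear`); hence no ear of `B` leaves a broom behind.

Suppose the broom misses a vertex. Let `R` be the vertices outside `B` with at least two neighbours
in `B`. Each is a one-vertex ear, so every broom outside `B` contains `R`. So does every path of
order `r + 2` outside `B` that starts off `R`, since its first vertex has enough neighbours to be
the centre of a broom. Such a path exists (`exists_path_of_broom`), and sliding it forward one
vertex at a time pushes `R` off its tail, so `R` is empty (`eq_empty_of_forall_path`). Now a
shortest ear together with `B` takes at most three neighbours from any other vertex, so a broom
survives (`exists_isEar_hasBroom`), a contradiction. -/

namespace PathStarKeeping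

open Finset

/-! ### Paths as lists -/

section Paths

variable {V : Type*} (G : SimpleGraph V)

/-- The vertices of the list `l` form, in this order, a path of `G` inside `U`. -/
structure IsPathIn (U : Finset V) (l : List V) : Prop where
  chain : l.IsChain G.Adj
  nodup : l.Nodup
  mem : ∀ x ∈ l, x ∈ U

variable {G}

lemma IsPathIn.take {U : Finset V} {l : List V} (h : IsPathIn G U l) (n : ℕ) :
    IsPathIn G U (l.take n) :=
  ⟨h.chain.take n, h.nodup.sublist (List.take_sublist n l), fun x hx => h.mem x (List.mem_of_mem_take hx)⟩

/-- Some final segment of a list starts with a neighbour of `w`, or is empty, and contains all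
neighbours of `w` on the list. -/
lemma exists_suffix_adj (w : V) (l : List V) :
    ∃ l₁ l₂, l = l₁ ++ l₂ ∧ (∀ x ∈ l, G.Adj w x → x ∈ l₂) ∧ ∀ x ∈ l₂.head?, G.Adj w x := by
  classical
  induction l with
  | nil => exact ⟨[], [], by simp⟩
  | cons a l ih =>
    by_cases ha : G.Adj w a
    · exact ⟨[], a :: l, rfl, fun x hx _ => hx, by simp [ha]⟩
    · obtain ⟨l₁, l₂, rfl, h1, h2⟩ := ih
      refine ⟨a :: l₁, l₂, by simp, ?_, h2⟩
      intro x hx hwx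
      rcases List.mem_cons.1 hx with rfl | hx
      · exact absurd hwx ha
      · exact h1 x hx hwx

end Paths

/-! ### Brooms and paths from degree conditions -/

section Brooms

variable {V : Type*} [Fintype V] [DecidableEq V] (G : SimpleGraph V) [DecidableRel G.Adj]

/-- `U` contains a path `a :: l` of order `r + 2` together with `m - (r + 2)` further neighbours
of `a`. -/
def HasBroom (r m : ℕ) (U : Finset V) : Prop :=
  ∃ (a : V) (l F : List V), (a :: l).IsChain G.Adj ∧ l.length = r + 1 ∧ (∀ y ∈ F, G.Adj a y) ∧
    F.length = m - (r + 2) ∧ (a :: l ++ F).Nodup ∧ ∀ x ∈ a :: l ++ F, x ∈ U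

variable {G}

lemma IsPathIn.exists_cons {U : Finset V} {a : V} {l : List V} (h : IsPathIn G U (a :: l))
    (hd : l.length < (G.neighborFinset a ∩ U).card) : ∃ y, IsPathIn G U (y :: a :: l) := by
  have hlt : l.toFinset.card < (G.neighborFinset a ∩ U).card :=
    (List.toFinset_card_le l).trans_lt hd
  obtain ⟨y, hy, hyl⟩ := Finset.exists_mem_notMem_of_card_lt_card hlt
  simp only [Finset.mem_inter, SimpleGraph.mem_neighborFinset, List.mem_toFinset] at hy hyl
  refine ⟨y, List.isChain_cons_cons.2 ⟨hy.1.symm, h.chain⟩, List.nodup_cons.2 ⟨?_, h.nodup⟩, ?_⟩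
  · simp only [List.mem_cons, not_or]
    exact ⟨hy.1.ne', hyl⟩
  · simp only [List.mem_cons, forall_eq_or_imp]
    exact ⟨hy.2, h.mem a (by simp), fun x hx => h.mem x (by simp [hx])⟩

/-- In a set where all inner degrees are at least `n`, every vertex is the end of a path of order
`n + 1`. -/
lemma exists_path_of_le_degree {U : Finset V} {n : ℕ}
    (hd : ∀ u ∈ U, n ≤ (G.neighborFinset u ∩ U).card) {u : V} (hu : u ∈ U) :
    ∃ l, IsPathIn G U (l ++ [u]) ∧ l.length = n := by
  suffices H : ∀ k ≤ n, ∃ l, IsPathIn G U (l ++ [u]) ∧ l.length = k from H n le_rfl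
  intro k
  induction k with
  | zero => exact fun _ => ⟨[], ⟨by simp, by simp, by simpa using hu⟩, rfl⟩
  | succ k ih =>
    intro hk
    obtain ⟨l, hl, hlen⟩ := ih (by omega)
    obtain ⟨a, l', hal⟩ : ∃ a l', l ++ [u] = a :: l' :=
      List.exists_cons_of_ne_nil (by simp)
    have hlen' : l'.length = k := by
      have := congrArg List.length hal
      simp at this
      omega
    rw [hal] at hl
    obtain ⟨y, hy⟩ := hl.exists_cons
      (lt_of_lt_of_le (by omega) (hd a (hl.mem a (by simp))))
    exact ⟨y :: l, by simpa [hal] using hy, by simp [hlen]⟩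

/-- The path uses at most `r + 1` of the `m - 1` neighbours of `a`, which leaves the required `m -
(r + 2)` leaves. -/
lemma hasBroom_of_path {r m : ℕ} (hrm : r + 3 ≤ m) {U : Finset V} {a : V} {l : List V}
    (h : IsPathIn G U (a :: l)) (hlen : r + 1 ≤ l.length)
    (hd : m - 1 ≤ (G.neighborFinset a ∩ U).card) : HasBroom G r m U := by
  set l₀ := l.take (r + 1) with hl₀
  have h₀ : IsPathIn G U (a :: l₀) := by simpa [hl₀] using h.take (r + 2)
  have hlen₀ : l₀.length = r + 1 := by simp [hl₀, hlen]
  have hcard : m - (r + 2) ≤ ((G.neighborFinset a ∩ U) \ l₀.toFinset).card := by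
    have h1 := Finset.le_card_sdiff l₀.toFinset (G.neighborFinset a ∩ U)
    have h2 := List.toFinset_card_le l₀
    omega
  obtain ⟨F, hF, hFc⟩ := Finset.exists_subset_card_eq hcard
  have hF' : ∀ y ∈ F, G.Adj a y ∧ y ∈ U ∧ y ∉ l₀ := fun y hy => by
    have := hF hy
    simp only [Finset.mem_sdiff, Finset.mem_inter, SimpleGraph.mem_neighborFinset,
      List.mem_toFinset] at this
    tauto
  refine ⟨a, l₀, F.toList, h₀.chain, hlen₀, fun y hy => (hF' y (by simpa using hy)).1,
    by simp [hFc], ?_, ?_⟩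
  · rw [List.nodup_append]
    refine ⟨h₀.nodup, Finset.nodup_toList F, fun x hx y hy hxy => ?_⟩
    subst hxy
    have := hF' x (by simpa using hy)
    rcases List.mem_cons.1 hx with rfl | hx
    · exact G.loopless.irrefl _ this.1
    · exact this.2.2 hx
  · intro x hx
    rcases List.mem_append.1 hx with hx | hx
    · exact h₀.mem x hx
    · exact (hF' x (by simpa using hx)).2.1

/-- A set properly containing a broom, whose vertices outside the broom have degree greater than
`m` in it, contains a path of order `r + 2` starting outside the broom. -/
lemma exists_path_of_broom {r m : ℕ} (hrm : r + 3 ≤ m) {W : Finset V} {a : V} {l F : List V}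
    (hc : (a :: l).IsChain G.Adj) (hl : l.length = r + 1) (hF : ∀ y ∈ F, G.Adj a y)
    (hnd : (a :: l ++ F).Nodup) (hW : ∀ x ∈ a :: l ++ F, x ∈ W)
    (hne : ∃ w ∈ W, w ∉ a :: l ++ F)
    (hd : ∀ w ∈ W, w ∉ a :: l ++ F → m + 1 ≤ (G.neighborFinset w ∩ W).card) :
    ∃ q p, q ∉ a :: l ++ F ∧ p.length = r + 1 ∧ IsPathIn G W (q :: p) := by
  set T := (a :: l ++ F).toFinset with hT
  have hne' : (W \ T).Nonempty := by
    obtain ⟨w, hw, hwT⟩ := hne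
    exact ⟨w, by simp only [hT, Finset.mem_sdiff, List.mem_toFinset]; exact ⟨hw, hwT⟩⟩
  obtain ⟨w, hwWT, hmax⟩ := Finset.exists_max_image (W \ T)
    (fun w => (G.neighborFinset w ∩ T).card) hne'
  have hw : w ∈ W ∧ w ∉ a :: l ++ F := by simpa only [hT, Finset.mem_sdiff, List.mem_toFinset] using hwWT
  have hwa : w ∉ a :: l := fun h => hw.2 (List.mem_append_left F h)
  have hP : IsPathIn G W (a :: l) :=
    ⟨hc, (List.nodup_append.1 hnd).1, fun x hx => hW x (List.mem_append_left F hx)⟩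
  by_cases h1 : G.Adj w a
  · refine ⟨w, a :: l.take r, hw.2, by simp [hl], ?_⟩
    have : IsPathIn G W (w :: a :: l) :=
      ⟨List.isChain_cons_cons.2 ⟨h1, hc⟩, List.nodup_cons.2 ⟨hwa, hP.nodup⟩,
        by simpa using ⟨hw.1, by simpa using hP.mem⟩⟩
    simpa using this.take (r + 2)
  by_cases h2 : ∃ y ∈ F, G.Adj w y
  · obtain ⟨y, hy, hwy⟩ := h2
    have hyl : y ∉ a :: l := fun h => (List.nodup_append.1 hnd).2.2 y h y hy rfl
    have h3 : IsPathIn G W (w :: y :: a :: l) :=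
      ⟨List.isChain_cons_cons.2 ⟨hwy, List.isChain_cons_cons.2 ⟨(hF y hy).symm, hc⟩⟩,
        List.nodup_cons.2 ⟨fun h => (List.mem_cons.1 h).elim (fun h => hwy.ne h) hwa,
          List.nodup_cons.2 ⟨hyl, hP.nodup⟩⟩,
        by simpa using ⟨hw.1, hW y (List.mem_append_right _ hy), by simpa using hP.mem⟩⟩
    exact ⟨w, (y :: a :: l).take (r + 1), hw.2, by simp [hl]; omega, by simpa using h3.take (r + 2)⟩
  push Not at h2
  -- All `s` neighbours of `w` in the broom now lie on the suffix `l₂`. As `s` is maximal, degrees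
  -- inside `W \ T` are at least `m + 1 - s`; a path there ending in `w`, continued along `l₂`, has
  -- order at least `m + 2`.
  obtain ⟨l₁, l₂, hll, hmem, hhead⟩ := exists_suffix_adj w l
  set s := (G.neighborFinset w ∩ T).card with hs
  have hs₂ : s ≤ l₂.length := by
    refine (Finset.card_le_card fun x hx => ?_).trans (List.toFinset_card_le l₂)
    simp only [hT, Finset.mem_inter, SimpleGraph.mem_neighborFinset, List.mem_toFinset,
      List.mem_append, List.mem_cons] at hx ⊢
    rcases hx with ⟨hwx, (rfl | hx) | hx⟩
    · exact absurd hwx h1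
    · exact hmem x hx hwx
    · exact absurd hwx (h2 x hx)
  have hdeg : ∀ u ∈ W \ T, m + 1 - s ≤ (G.neighborFinset u ∩ (W \ T)).card := by
    intro u hu
    have h3 := hmax u hu
    have hu' : u ∈ W ∧ u ∉ a :: l ++ F := by
      simpa only [hT, Finset.mem_sdiff, List.mem_toFinset] using hu
    have h4 := hd u hu'.1 hu'.2
    have h5 : (G.neighborFinset u ∩ W).card ≤
        (G.neighborFinset u ∩ T).card + (G.neighborFinset u ∩ (W \ T)).card := by
      refine (Finset.card_le_card fun x hx => ?_).trans (Finset.card_union_le _ _)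
      simp only [Finset.mem_union, Finset.mem_inter, Finset.mem_sdiff] at hx ⊢
      tauto
    omega
  obtain ⟨p, hp, hpl⟩ := exists_path_of_le_degree hdeg hwWT
  have hpath : IsPathIn G W (p ++ [w] ++ l₂) := by
    have hl₂ : ∀ x ∈ l₂, x ∈ a :: l := fun x hx => by simp [hll, hx]
    refine ⟨hp.chain.append (List.isChain_append.1 (hll ▸ List.isChain_cons.1 hc |>.2)).2.1 ?_,
      List.nodup_append.2 ⟨hp.nodup, ?_, ?_⟩, ?_⟩
    · simpa using hhead
    · have := (List.nodup_cons.1 hP.nodup).2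
      rw [hll] at this
      exact (List.nodup_append.1 this).2.1
    · rintro x hx y hy rfl
      have := hp.mem x hx
      simp only [hT, Finset.mem_sdiff, List.mem_toFinset] at this
      exact this.2 (List.mem_append_left F (hl₂ x hy))
    · intro x hx
      rcases List.mem_append.1 hx with hx | hx
      · exact (Finset.mem_sdiff.1 (hp.mem x hx)).1
      · exact hP.mem x (hl₂ x hx)
  obtain ⟨q, p', hqp⟩ : ∃ q p', p ++ [w] = q :: p' := List.exists_cons_of_ne_nil (by simp)
  have hq : q ∉ a :: l ++ F := by
    have := hp.mem q (by simp [hqp])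
    simp only [hT, Finset.mem_sdiff, List.mem_toFinset] at this
    exact this.2
  have hp'l : p'.length = m + 1 - s := by
    have := congrArg List.length hqp
    simp only [List.length_append, List.length_cons, List.length_nil] at this
    omega
  rw [hqp] at hpath
  exact ⟨q, (p' ++ l₂).take (r + 1), hq, by simp; omega, by simpa using hpath.take (r + 2)⟩

/-- If every path of order `r + 2` in `W` starting outside `R` passes through all of `R`, and
there is such a path, then `R` is empty. -/
lemma eq_empty_of_forall_path {r : ℕ} {W R : Finset V}
    (hd : ∀ q ∈ W, q ∉ R → r + 1 < (G.neighborFinset q ∩ W).card)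
    (hall : ∀ q p, q ∉ R → p.length = r + 1 → IsPathIn G W (q :: p) → ∀ x ∈ R, x ∈ q :: p)
    (hex : ∃ q p, q ∉ R ∧ p.length = r + 1 ∧ IsPathIn G W (q :: p)) : R = ∅ := by
  have H : ∀ k ≤ r + 1, ∃ q p, q ∉ R ∧ p.length = r + 1 ∧ IsPathIn G W (q :: p) ∧
      ∀ x ∈ p.take k, x ∉ R := by
    intro k
    induction k with
    | zero =>
      intro _
      obtain ⟨q, p, hq, hp, h⟩ := hex
      exact ⟨q, p, hq, hp, h, by simp⟩
    | succ k ih =>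
      intro hk
      obtain ⟨q, p, hq, hp, h, hx⟩ := ih (by omega)
      obtain ⟨y, hy⟩ := h.exists_cons (by rw [hp]; exact hd q (h.mem q (by simp)) hq)
      -- The old path already contains all of `R`, so a new first vertex avoids `R`; dropping the
      -- last vertex restores the order.
      have hyR : y ∉ R := fun hyR => (List.nodup_cons.1 hy.nodup).1 (hall q p hq hp h y hyR)
      refine ⟨y, (q :: p).take (r + 1), hyR, by simp [hp], by simpa using hy.take (r + 2), ?_⟩
      intro x hx'
      rw [List.take_take, Nat.min_eq_left hk, List.take_succ_cons] at hx'
      rcases List.mem_cons.1 hx' with rfl | hx'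
      · exact hq
      · exact hx x hx'
  obtain ⟨q, p, hq, hp, h, hx⟩ := H (r + 1) le_rfl
  rw [List.take_of_length_le hp.le] at hx
  refine Finset.eq_empty_of_forall_notMem fun x hxR => ?_
  rcases List.mem_cons.1 (hall q p hq hp h x hxR) with rfl | hxp
  · exact hq hxR
  · exact hx x hxp hxR

end Brooms

/-! ### Biconnected sets and shortest ears -/

section Ears

variable {V : Type*} {G : SimpleGraph V}

lemma connected_induce_union_list {s : Set V} {l : List V} (hs : (G.induce s).Connected)
    (hl : l.IsChain G.Adj) (hhead : ∀ x ∈ l.head?, ∃ b ∈ s, G.Adj b x) :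
    (G.induce (s ∪ {x | x ∈ l})).Connected := by
  induction l generalizing s with
  | nil =>
    have : s ∪ {x | x ∈ ([] : List V)} = s := by ext x; simp
    rwa [this]
  | cons a l ih =>
    obtain ⟨b, hb, hba⟩ := hhead a (by simp)
    have h1 : (G.induce (s ∪ {a})).Connected :=
      SimpleGraph.connected_induce_union hs.preconnected
        (SimpleGraph.Preconnected.of_subsingleton) hb (Set.mem_singleton a) hba
    have h2 := ih h1 (List.isChain_cons.1 hl).2
      fun x hx => ⟨a, by simp, (List.isChain_cons.1 hl).1 x hx⟩
    have h3 : s ∪ {x | x ∈ a :: l} = s ∪ {a} ∪ {x | x ∈ l} := by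
      ext x
      simp only [Set.mem_union, Set.mem_ofPred_eq, List.mem_cons, Set.mem_singleton_iff, or_assoc]
    rwa [h3]

variable (G) in
/-- `B` has at least two vertices and removing any vertex from `B` leaves a connected induced
subgraph. -/
structure IsBiconnectedSet (B : Finset V) : Prop where
  two_le_card : 2 ≤ B.card
  connected_diff : ∀ v, (G.induce ((B : Set V) \ {v})).Connected

variable [DecidableEq V]

lemma IsBiconnectedSet.pair {a b : V} (hab : G.Adj a b) : IsBiconnectedSet G {a, b} := by
  refine ⟨(Finset.card_pair hab.ne).ge, fun v => ?_⟩
  have key : ∀ c d : V, c ≠ d → (G.induce (({c, d} : Set V) \ {c})).Connected := by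
    intro c d hcd
    have : (({c, d} : Set V) \ {c}) = {d} := by
      ext x
      simp only [Set.mem_sdiff, Set.mem_insert_iff, Set.mem_singleton_iff]
      grind
    rw [this]
    exact SimpleGraph.Connected.of_subsingleton
  rw [Finset.coe_pair]
  by_cases hva : v = a
  · subst hva
    exact key _ _ hab.ne
  by_cases hvb : v = b
  · rw [Set.pair_comm]
    subst hvb
    exact key _ _ hab.ne'
  · rw [Set.sdiff_singleton_eq_self (by simp [hva, hvb])]
    exact SimpleGraph.induce_pair_connected_of_adj hab

variable [Fintype V]

variable (G) in
/-- `l` is a path outside `B` whose ends are adjacent to two different vertices of `B`. -/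
structure IsEar (B : Finset V) (l : List V) : Prop where
  isPathIn : IsPathIn G Bᶜ l
  ends : ∃ b₁ ∈ B, ∃ b₂ ∈ B, b₁ ≠ b₂ ∧ (∃ x ∈ l.head?, G.Adj b₁ x) ∧ ∃ y ∈ l.getLast?, G.Adj b₂ y

lemma IsEar.reverse {B : Finset V} {l : List V} (h : IsEar G B l) : IsEar G B l.reverse := by
  obtain ⟨b₁, hb₁, b₂, hb₂, hne, h₁, h₂⟩ := h.ends
  exact ⟨⟨List.isChain_reverse.2 (h.isPathIn.chain.imp fun _ _ => SimpleGraph.Adj.symm),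
    List.nodup_reverse.2 h.isPathIn.nodup, fun x hx => h.isPathIn.mem x (List.mem_reverse.1 hx)⟩,
    b₂, hb₂, b₁, hb₁, hne.symm, by simpa using h₂, by simpa using h₁⟩

lemma isEar_singleton {B : Finset V} {x b₁ b₂ : V} (hx : x ∉ B) (hb₁ : b₁ ∈ B) (hb₂ : b₂ ∈ B)
    (hne : b₁ ≠ b₂) (h₁ : G.Adj b₁ x) (h₂ : G.Adj b₂ x) : IsEar G B [x] :=
  ⟨⟨by simp, by simp, by simpa using hx⟩, b₁, hb₁, b₂, hb₂, hne, ⟨x, by simp, h₁⟩, x, by simp, h₂⟩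

/-- Deleting a vertex of the ear leaves two pieces, each attached to `B` at its own end. Deleting
any other vertex spares one of the two distinct attachment vertices. -/
lemma IsBiconnectedSet.union_ear {B : Finset V} {l : List V} (hB : IsBiconnectedSet G B)
    (hl : IsEar G B l) : IsBiconnectedSet G (B ∪ l.toFinset) := by
  refine ⟨hB.two_le_card.trans (Finset.card_le_card Finset.subset_union_left), fun v => ?_⟩
  by_cases hv : v ∈ l
  · obtain ⟨l₁, l₂, rfl⟩ := List.append_of_mem hv
    obtain ⟨b₁, hb₁, b₂, hb₂, hne, ⟨x, hx, hbx⟩, y, hy, hby⟩ := hl.ends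
    have hvB : v ∉ B := by simpa using hl.isPathIn.mem v hv
    have hBc : (G.induce (B : Set V)).Connected := by
      have := hB.connected_diff v
      rwa [Set.sdiff_singleton_eq_self (by simpa using hvB)] at this
    have hch := List.isChain_append.1 hl.isPathIn.chain
    have h₁ := connected_induce_union_list hBc hch.1 (by
      intro z hz
      refine ⟨b₁, hb₁, ?_⟩
      have : x = z := by
        cases l₁ with
        | nil => simp at hz
        | cons c l₁ => simp at hx hz; exact hx.symm.trans hz
      exact this ▸ hbx)
    have h₂ := connected_induce_union_list (l := l₂.reverse) h₁
      (List.isChain_reverse.2 ((List.isChain_cons.1 hch.2.1).2.imp fun _ _ => SimpleGraph.Adj.symm))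
      (by
        intro z hz
        refine ⟨b₂, Or.inl hb₂, ?_⟩
        have : y = z := by
          rw [List.head?_reverse] at hz
          cases l₂ using List.reverseRecOn with
          | nil => simp at hz
          | append_singleton l₂ c =>
            simp [List.getLast?_cons, List.getLast?_append] at hy hz
            exact hy.symm.trans hz
        exact this ▸ hby)
    suffices hset : ((B ∪ (l₁ ++ v :: l₂).toFinset : Finset V) : Set V) \ {v} =
        (B : Set V) ∪ {x | x ∈ l₁} ∪ {x | x ∈ l₂.reverse} by rwa [hset]
    ext z
    have hnd := hl.isPathIn.nodup
    simp only [List.nodup_append, List.nodup_cons] at hnd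
    simp only [Finset.coe_union, List.coe_toFinset, Set.mem_sdiff, Set.mem_union, Finset.mem_coe,
      Set.mem_ofPred_eq, List.mem_append, List.mem_cons, Set.mem_singleton_iff, List.mem_reverse]
    constructor
    · tauto
    · rintro ((h | h) | h)
      · exact ⟨Or.inl h, fun e => hvB (e ▸ h)⟩
      · exact ⟨Or.inr (Or.inl h), fun e => hnd.2.2 z h v (by simp) e⟩
      · exact ⟨Or.inr (Or.inr (Or.inr h)), fun e => hnd.2.1.1 (e ▸ h)⟩
  · have key : ∀ l', IsEar G B l' → (∃ b ∈ B, b ≠ v ∧ ∃ x ∈ l'.head?, G.Adj b x) →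
        (G.induce (((B : Set V) \ {v}) ∪ {x | x ∈ l'})).Connected := by
      rintro l' hl' ⟨b, hb, hbv, x, hx, hbx⟩
      refine connected_induce_union_list (hB.connected_diff v) hl'.isPathIn.chain fun z hz => ?_
      exact ⟨b, ⟨hb, hbv⟩, Option.mem_unique hx hz ▸ hbx⟩
    have hset : ((B ∪ l.toFinset : Finset V) : Set V) \ {v} = ((B : Set V) \ {v}) ∪ {x | x ∈ l} := by
      rw [Finset.coe_union, Set.union_sdiff_distrib, List.coe_toFinset,
        Set.sdiff_singleton_eq_self (s := {x | x ∈ l}) hv]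
    rw [hset]
    obtain ⟨b₁, hb₁, b₂, hb₂, hne, h₁, h₂⟩ := hl.ends
    by_cases hbv : b₁ = v
    · have := key l.reverse hl.reverse ⟨b₂, hb₂, fun e => hne (hbv.trans e.symm), by simpa using h₂⟩
      have hrev : {x | x ∈ l.reverse} = {x | x ∈ l} := by
        ext x
        simp
      rwa [hrev] at this
    · exact key l hl ⟨b₁, hb₁, hbv, h₁⟩

/-- In a `2`-connected graph every proper subset with at least two vertices has an ear. -/
lemma exists_isEar (hG : IsVertexConnected 2 G) {B : Finset V} (hB : 2 ≤ B.card) {w : V}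
    (hw : w ∉ B) : ∃ l, IsEar G B l := by
  have hw' : w ∈ (B : Set V)ᶜ := by simpa using hw
  set C : Set V :=
    {c | ∃ hc : c ∈ (B : Set V)ᶜ, (G.induce (B : Set V)ᶜ).Reachable ⟨w, hw'⟩ ⟨c, hc⟩} with hC
  have hwC : w ∈ C := ⟨hw', SimpleGraph.Reachable.refl _⟩
  -- `C` is the component of `w` off `B`. Since `G - b` is connected, `C` attaches to `B` away from
  -- `b`; using this twice gives two distinct attachment vertices.
  have key : ∀ b ∈ B, ∃ c ∈ C, ∃ b' ∈ B, b' ≠ b ∧ G.Adj c b' := by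
    intro b hb
    obtain ⟨b'', hb'', hne⟩ := Finset.exists_mem_ne hB b
    have hcon := hG.2 {b} (by simp)
    have hwb : w ∈ (({b} : Finset V) : Set V)ᶜ := by
      simpa using fun e : w = b => hw (e ▸ hb)
    have hbb : b'' ∈ (({b} : Finset V) : Set V)ᶜ := by simpa using hne
    obtain ⟨p⟩ := hcon.preconnected ⟨w, hwb⟩ ⟨b'', hbb⟩
    obtain ⟨d, -, hd1, hd2⟩ := p.exists_boundary_dart {x | x.1 ∈ C} hwC
      (fun h : b'' ∈ C => h.1 hb'')
    have hadj : G.Adj d.fst.1 d.snd.1 := d.adj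
    refine ⟨d.fst.1, hd1, d.snd.1, ?_, by simpa using d.snd.2, hadj⟩
    by_contra hB'
    obtain ⟨hc, hr⟩ := hd1
    refine hd2 ⟨by simpa using hB', hr.trans (SimpleGraph.Adj.reachable ?_)⟩
    exact hadj
  obtain ⟨b₀, hb₀⟩ : B.Nonempty := Finset.card_pos.1 (by omega)
  obtain ⟨c₁, ⟨hc₁, hr₁⟩, b₁, hb₁, -, h₁⟩ := key b₀ hb₀
  obtain ⟨c₂, ⟨hc₂, hr₂⟩, b₂, hb₂, hne, h₂⟩ := key b₁ hb₁
  obtain ⟨p, hp⟩ := (hr₁.symm.trans hr₂).exists_isPath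
  refine ⟨p.support.map Subtype.val, ⟨?_, hp.support_nodup.map Subtype.val_injective, ?_⟩,
    b₁, hb₁, b₂, hb₂, hne.symm, ⟨c₁, ?_, h₁.symm⟩, c₂, ?_, h₂.symm⟩
  · rw [List.isChain_map]
    exact p.isChain_adj_support
  · simp only [List.mem_map]
    rintro _ ⟨x, -, rfl⟩
    exact Finset.mem_compl.2 x.2
  · rw [← SimpleGraph.Walk.cons_tail_support]
    rfl
  · rw [List.getLast?_map, List.getLast?_eq_some_getLast p.support_ne_nil]
    simp

/-- Rerouting an ear through an outside vertex adjacent to two vertices of it. -/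
lemma IsEar.reroute {B : Finset V} {l₁ m l₂ : List V} {x v y : V}
    (h : IsEar G B (l₁ ++ x :: (m ++ y :: l₂))) (hvB : v ∉ B)
    (hv : v ∉ l₁ ++ x :: (m ++ y :: l₂)) (hx : G.Adj x v) (hy : G.Adj v y) :
    IsEar G B (l₁ ++ x :: v :: y :: l₂) := by
  obtain ⟨b₁, hb₁, b₂, hb₂, hne, h₁, h₂⟩ := h.ends
  refine ⟨⟨?_, ?_, ?_⟩, b₁, hb₁, b₂, hb₂, hne, ?_, ?_⟩
  · have := h.isPathIn.chain
    grind [List.isChain_append, List.isChain_cons]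
  · have := h.isPathIn.nodup
    grind [List.nodup_append, List.nodup_cons]
  · have := h.isPathIn.mem
    simp only [Finset.mem_compl] at this ⊢
    grind
  · cases l₁ <;> simpa using h₁
  · simpa [List.getLast?_append, List.getLast?_cons] using h₂

/-- Cutting off an ear at a vertex adjacent to the head. -/
lemma IsEar.shortcut {B : Finset V} {m l₂ : List V} {x y : V}
    (h : IsEar G B (x :: (m ++ y :: l₂))) (hxy : G.Adj x y) : IsEar G B (x :: y :: l₂) := by
  obtain ⟨b₁, hb₁, b₂, hb₂, hne, h₁, h₂⟩ := h.ends
  refine ⟨⟨?_, ?_, ?_⟩, b₁, hb₁, b₂, hb₂, hne, by simpa using h₁, ?_⟩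
  · have := h.isPathIn.chain
    grind [List.isChain_append, List.isChain_cons]
  · have := h.isPathIn.nodup
    grind [List.nodup_append, List.nodup_cons]
  · have := h.isPathIn.mem
    simp only [Finset.mem_compl] at this ⊢
    grind
  · simpa [List.getLast?_append, List.getLast?_cons] using h₂

/-- Ending an ear early through an outside vertex with a suitable neighbour in `B`. -/
lemma IsEar.cut {B : Finset V} {l₁ l₂ : List V} {x v b c : V}
    (h : IsPathIn G Bᶜ (l₁ ++ x :: l₂)) (hvB : v ∉ B) (hv : v ∉ l₁ ++ x :: l₂) (hx : G.Adj x v)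
    (hb : b ∈ B) (hc : c ∈ B) (hbc : c ≠ b) (hhead : ∃ z ∈ (l₁ ++ x :: l₂).head?, G.Adj c z)
    (hvb : G.Adj v b) : IsEar G B (l₁ ++ [x, v]) := by
  refine ⟨⟨?_, ?_, ?_⟩, c, hc, b, hb, hbc, ?_, ?_⟩
  · have := h.chain
    grind [List.isChain_append, List.isChain_cons]
  · have := h.nodup
    grind [List.nodup_append, List.nodup_cons]
  · have := h.mem
    simp only [Finset.mem_compl] at this ⊢
    grind
  · cases l₁ <;> simpa using hhead
  · exact ⟨v, by simp, hvb.symm⟩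

variable [DecidableRel G.Adj]

/-- Rerouting through `v` from its first neighbour on the ear to a later one cannot shorten the ear,
so at most one vertex lies between them. -/
lemma IsEar.card_neighbors_le {B : Finset V} {l : List V} (h : IsEar G B l)
    (hmin : ∀ l', IsEar G B l' → l.length ≤ l'.length) {v : V} (hvB : v ∉ B) (hv : v ∉ l) :
    (G.neighborFinset v ∩ l.toFinset).card ≤ 3 := by
  obtain ⟨l₁, l₂, rfl, hmem, hhead⟩ := exists_suffix_adj (G := G) v l
  cases l₂ with
  | nil =>
    have : G.neighborFinset v ∩ (l₁ ++ []).toFinset = ∅ := by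
      ext x
      simpa using fun hx hxl => by simpa using hmem x (by simpa using hxl) hx
    rw [this]
    simp
  | cons x l₂ =>
    have hsub : G.neighborFinset v ∩ (l₁ ++ x :: l₂).toFinset ⊆ (x :: l₂.take 2).toFinset := by
      intro y hy
      simp only [Finset.mem_inter, SimpleGraph.mem_neighborFinset, List.mem_toFinset] at hy ⊢
      rcases List.mem_cons.1 (hmem y hy.2 hy.1) with rfl | hyl
      · simp
      · obtain ⟨m, l₃, rfl⟩ := List.append_of_mem hyl
        have := hmin _ (h.reroute hvB hv (hhead x (by simp)).symm hy.1)
        simp at this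
        refine List.mem_cons_of_mem _ ?_
        rw [List.take_append, List.take_cons (by omega)]
        simp
    refine (Finset.card_le_card hsub).trans ((List.toFinset_card_le _).trans ?_)
    simp

/-- Leaving the ear at the first neighbour of `v` and returning to `B` via `v` and `b` cannot be
shorter, so at most one ear vertex follows. The ear must start at an attachment other than `b`, if
need be after reversal. -/
lemma IsEar.card_neighbors_le_of_adj {B : Finset V} {l : List V} (h : IsEar G B l)
    (hmin : ∀ l', IsEar G B l' → l.length ≤ l'.length) {v b : V} (hvB : v ∉ B) (hv : v ∉ l)
    (hb : b ∈ B) (hvb : G.Adj v b) :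
    (G.neighborFinset v ∩ l.toFinset).card ≤ 2 := by
  have key : ∀ l, IsEar G B l → (∀ l', IsEar G B l' → l.length ≤ l'.length) → v ∉ l →
      (∃ c ∈ B, c ≠ b ∧ ∃ z ∈ l.head?, G.Adj c z) →
      (G.neighborFinset v ∩ l.toFinset).card ≤ 2 := by
    rintro l h hmin hv ⟨c, hc, hcb, hz⟩
    obtain ⟨l₁, l₂, rfl, hmem, hhead⟩ := exists_suffix_adj (G := G) v l
    have hsub : G.neighborFinset v ∩ (l₁ ++ l₂).toFinset ⊆ l₂.toFinset := by
      intro y hy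
      simp only [Finset.mem_inter, SimpleGraph.mem_neighborFinset, List.mem_toFinset] at hy ⊢
      exact hmem y hy.2 hy.1
    refine (Finset.card_le_card hsub).trans ((List.toFinset_card_le _).trans ?_)
    cases l₂ with
    | nil => simp
    | cons x l₂ =>
      have := hmin _ (IsEar.cut h.isPathIn hvB hv (hhead x (by simp)).symm hb hc hcb hz hvb)
      simp at this ⊢
      omega
  obtain ⟨b₁, hb₁, b₂, hb₂, hne, h₁, h₂⟩ := h.ends
  by_cases hbb : b₁ = b
  · have := key l.reverse h.reverse (by simpa using hmin) (by simpa using hv)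
      ⟨b₂, hb₂, fun e => hne (hbb.trans e.symm), by simpa using h₂⟩
    simpa using this
  · exact key l h hmin hv ⟨b₁, hb₁, hbb, h₁⟩

lemma IsEar.card_head_neighbors_le {B : Finset V} {x : V} {l : List V} (h : IsEar G B (x :: l))
    (hmin : ∀ l', IsEar G B l' → (x :: l).length ≤ l'.length) :
    (G.neighborFinset x ∩ (x :: l).toFinset).card ≤ 1 := by
  have hsub : G.neighborFinset x ∩ (x :: l).toFinset ⊆ (l.take 1).toFinset := by
    intro y hy
    simp only [Finset.mem_inter, SimpleGraph.mem_neighborFinset, List.mem_toFinset,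
      List.mem_cons] at hy ⊢
    rcases hy.2 with rfl | hyl
    · exact absurd hy.1 (G.loopless.irrefl _)
    · obtain ⟨m, l₃, rfl⟩ := List.append_of_mem hyl
      have := hmin _ (h.shortcut hy.1)
      simp at this
      simp [this]
  refine (Finset.card_le_card hsub).trans ((List.toFinset_card_le _).trans ?_)
  simp

end Ears

/-! ### From lists and vertex sets to subgraphs and connectivity -/

section Embedding

variable {V : Type*} {G : SimpleGraph V}

/-- A path together with further neighbours of its head forms a path-star. -/
lemma exists_subgraph_iso_pathStar {r m : ℕ} (hrm : r + 3 ≤ m) {a : V} {l F : List V}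
    (hc : (a :: l).IsChain G.Adj) (hl : l.length = r + 1) (hF : ∀ y ∈ F, G.Adj a y)
    (hFl : F.length = m - (r + 2)) (hnd : (a :: l ++ F).Nodup) :
    ∃ T : G.Subgraph, Nonempty (pathStar r (m - r) ≃g T.coe) ∧
      ∀ x, x ∈ T.verts ↔ x ∈ a :: l ++ F := by
  -- Reversal puts the centre `a` at index `r + 1`, as in `pathStar`.
  set P := (a :: l).reverse with hP
  have hPl : P.length = r + 2 := by simp [hP, hl]
  have hPc : P.IsChain G.Adj := List.isChain_reverse.2 (hc.imp fun _ _ => SimpleGraph.Adj.symm)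
  have hPa : P[r + 1]'(by omega) = a := by simp [hP, hl]
  have hlen : (P ++ F).length = r + (m - r) := by simp [hPl, hFl]; omega
  have hmem : ∀ x, x ∈ P ++ F ↔ x ∈ a :: l ++ F := fun x => by
    simp only [hP, List.mem_append, List.mem_reverse]
  have hnd' : (P ++ F).Nodup := by
    have : (P ++ F).Perm (a :: l ++ F) := (List.reverse_perm _).append_right F
    exact this.nodup_iff.2 hnd
  have hrel : ∀ i j : ℕ, (hi : i < (P ++ F).length) → (hj : j < (P ++ F).length) → i ≠ j →
      (j = i + 1 ∧ j ≤ r) ∨ (i = r + 1 ∧ r ≤ j) → G.Adj (P ++ F)[i] (P ++ F)[j] := by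
    intro i j hi hj hij h
    rcases h with ⟨rfl, h⟩ | ⟨rfl, h⟩
    · rw [List.getElem_append_left (by omega), List.getElem_append_left (by omega)]
      exact hPc.getElem _ _
    · rw [List.getElem_append_left (by omega)]
      rcases (by omega : j = r ∨ r + 2 ≤ j) with rfl | h
      · rw [List.getElem_append_left (by omega)]
        exact (hPc.getElem _ _).symm
      · rw [List.getElem_append_right (by omega), hPa]
        exact hF _ (List.getElem_mem _)
  let f : SimpleGraph.Copy (pathStar r (m - r)) G :=
    ⟨⟨fun i => (P ++ F)[(i : ℕ)]'(by rw [hlen]; exact i.2), by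
      intro i j hij
      rw [pathStar, SimpleGraph.fromRel_adj] at hij
      have hne : (i : ℕ) ≠ j := fun e => hij.1 (Fin.ext e)
      rcases hij.2 with h | h
      · exact hrel _ _ _ _ hne h
      · exact (hrel _ _ _ _ hne.symm h).symm⟩, by
      intro i j hij
      exact Fin.ext (hnd'.getElem_inj_iff.1 hij)⟩
  refine ⟨f.toSubgraph, ⟨f.isoToSubgraph⟩, fun x => ?_⟩
  rw [← hmem, List.mem_iff_getElem]
  constructor
  · rintro ⟨i, -, rfl⟩
    exact ⟨i, by rw [hlen]; exact i.2, rfl⟩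
  · rintro ⟨i, hi, rfl⟩
    exact ⟨⟨i, by rwa [hlen] at hi⟩, trivial, rfl⟩

lemma connected_induce_induce {s : Set V} {t : Set s}
    (h : (G.induce (Subtype.val '' t)).Connected) : ((G.induce s).induce t).Connected := by
  let e : (G.induce s).induce t ≃g G.induce (Subtype.val '' t) :=
    ⟨Equiv.Set.image Subtype.val t Subtype.val_injective, Iff.rfl⟩
  exact e.connected_iff.2 h

/-- The vertex outside `B` serves the case of deleting nothing: removing it does not change `B`. -/
lemma IsBiconnectedSet.isVertexConnected {B : Finset V} (hB : IsBiconnectedSet G B)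
    (hB3 : 3 ≤ B.card) (hne : ∃ v, v ∉ B) {s : Set V} (hs : ∀ x, x ∈ s ↔ x ∈ B) :
    IsVertexConnected 2 (G.induce s) := by
  obtain rfl : s = (B : Set V) := Set.ext hs
  refine ⟨?_, fun S hS => connected_induce_induce ?_⟩
  · have : ENat.card ((B : Set V) : Type _) = (B.card : ℕ∞) := by simp
    rw [this]
    exact_mod_cast hB3
  · obtain ⟨v, hv⟩ : ∃ v : V, Subtype.val '' ((S : Set (B : Set V))ᶜ) = (B : Set V) \ {v} := by
      rcases (by omega : S.card = 0 ∨ S.card = 1) with h | h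
      · obtain ⟨v, hv⟩ := hne
        rw [Finset.card_eq_zero] at h
        refine ⟨v, ?_⟩
        rw [h, Set.sdiff_singleton_eq_self (by simpa using hv)]
        simp
      · obtain ⟨v, rfl⟩ := Finset.card_eq_one.1 h
        refine ⟨v, ?_⟩
        rw [Set.image_compl_eq_range_sdiff_image Subtype.val_injective]
        simp
    rw [hv]
    exact hB.connected_diff v

end Embedding

/-! ### The maximal biconnected set -/

section Maximal

variable {V : Type*} [Fintype V] [DecidableEq V] {G : SimpleGraph V} [DecidableRel G.Adj]

lemma degree_le_card_inter_add (B P : Finset V) (v : V) :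
    G.degree v ≤ (G.neighborFinset v ∩ B).card + (G.neighborFinset v ∩ P).card +
      (G.neighborFinset v ∩ (Bᶜ \ P)).card := by
  rw [← SimpleGraph.card_neighborFinset_eq_degree]
  have : G.neighborFinset v ⊆ (G.neighborFinset v ∩ B ∪ G.neighborFinset v ∩ P) ∪
      G.neighborFinset v ∩ (Bᶜ \ P) := by
    intro x hx
    simp only [Finset.mem_union, Finset.mem_inter, Finset.mem_sdiff, Finset.mem_compl]
    tauto
  refine (Finset.card_le_card this).trans ((Finset.card_union_le _ _).trans ?_)
  exact Nat.add_le_add_right (Finset.card_union_le _ _) _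

variable {r m : ℕ} {B : Finset V}

lemma not_hasBroom_of_isEar (hB : IsBiconnectedSet G B)
    (hmax : ∀ B', IsBiconnectedSet G B' → HasBroom G r m B'ᶜ → B'.card ≤ B.card)
    {l : List V} (hl : IsEar G B l) : ¬ HasBroom G r m (Bᶜ \ l.toFinset) := by
  intro h
  rw [Finset.sdiff_eq_inter_compl, ← Finset.compl_union] at h
  refine (hmax _ (hB.union_ear hl) h).not_gt (Finset.card_lt_card ?_)
  obtain ⟨b₁, -, b₂, -, -, ⟨x, hx, -⟩, -⟩ := hl.ends
  have hxl : x ∈ l := List.mem_of_mem_head? hx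
  refine Finset.ssubset_iff_subset_ne.2 ⟨Finset.subset_union_left, fun e => ?_⟩
  have hxB : x ∈ B := by
    rw [e]
    simp [hxl]
  exact Finset.mem_compl.1 (hl.isPathIn.mem x hxl) hxB

/-- If no vertex outside `B` has two neighbours in `B`, a shortest ear leaves room for a broom. -/
lemma exists_isEar_hasBroom (hG : IsVertexConnected 2 G) (hrm : r + 3 ≤ m)
    (hdeg : ∀ v, m + 2 ≤ G.degree v) (hB : 2 ≤ B.card) (hne : ∃ w, w ∉ B)
    (hpoor : ∀ v ∉ B, (G.neighborFinset v ∩ B).card ≤ 1) :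
    ∃ l, IsEar G B l ∧ HasBroom G r m (Bᶜ \ l.toFinset) := by
  classical
  obtain ⟨w, hw⟩ := hne
  have hex : ∃ n l, IsEar G B l ∧ l.length = n := by
    obtain ⟨l, hl⟩ := exists_isEar hG hB hw
    exact ⟨_, l, hl, rfl⟩
  obtain ⟨l, hl, hlen⟩ := Nat.find_spec hex
  have hmin : ∀ l', IsEar G B l' → l.length ≤ l'.length := fun l' hl' =>
    hlen ▸ Nat.find_min' hex ⟨l', hl', rfl⟩
  refine ⟨l, hl, ?_⟩
  -- At most three neighbours are lost: three on the ear, or one in `B` and two on the ear.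
  have hd : ∀ u ∈ Bᶜ \ l.toFinset, m - 1 ≤ (G.neighborFinset u ∩ (Bᶜ \ l.toFinset)).card := by
    intro u hu
    simp only [Finset.mem_sdiff, Finset.mem_compl, List.mem_toFinset] at hu
    have h1 := degree_le_card_inter_add (G := G) B l.toFinset u
    have h2 := hdeg u
    have h3 := hpoor u hu.1
    rcases Finset.eq_empty_or_nonempty (G.neighborFinset u ∩ B) with h | ⟨b, hb⟩
    · have h4 := hl.card_neighbors_le hmin hu.1 hu.2
      rw [h, Finset.card_empty] at h1
      omega
    · simp only [Finset.mem_inter, SimpleGraph.mem_neighborFinset] at hb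
      have h4 := hl.card_neighbors_le_of_adj hmin hu.1 hu.2 hb.2 hb.1
      omega
  -- The head of the ear has at most one neighbour in `B` and one on the ear.
  obtain ⟨u, hu⟩ : (Bᶜ \ l.toFinset).Nonempty := by
    obtain ⟨b₁, -, b₂, -, -, ⟨x, hx, -⟩, -⟩ := hl.ends
    obtain ⟨l', rfl⟩ : ∃ l', l = x :: l' := List.head?_eq_some_iff.1 hx
    have h1 := degree_le_card_inter_add (G := G) B (x :: l').toFinset x
    have h2 := hdeg x
    have h3 := hpoor x (Finset.mem_compl.1 (hl.isPathIn.mem x (by simp)))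
    have h4 := hl.card_head_neighbors_le hmin
    obtain ⟨u, hu⟩ := Finset.card_pos.1 (by omega : 0 < (G.neighborFinset x ∩ (Bᶜ \ (x :: l').toFinset)).card)
    exact ⟨u, (Finset.mem_inter.1 hu).2⟩
  obtain ⟨p, hp, hpl⟩ := exists_path_of_le_degree hd hu
  obtain ⟨q, p', hqp⟩ : ∃ q p', p ++ [u] = q :: p' := List.exists_cons_of_ne_nil (by simp)
  have hp'l : p'.length = m - 1 := by
    have := congrArg List.length hqp
    simp only [List.length_append, List.length_cons, List.length_nil] at this
    omega
  rw [hqp] at hp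
  exact hasBroom_of_path hrm hp (by omega) (hd q (hp.mem q (by simp)))

/-- Every broom in the complement of a maximal `B` covers that complement. -/
lemma mem_broom_of_maximal (hG : IsVertexConnected 2 G) (hrm : r + 3 ≤ m)
    (hdeg : ∀ v, m + 2 ≤ G.degree v) (hB : IsBiconnectedSet G B)
    (hmax : ∀ B', IsBiconnectedSet G B' → HasBroom G r m B'ᶜ → B'.card ≤ B.card)
    {a : V} {l F : List V}
    (hc : (a :: l).IsChain G.Adj) (hl : l.length = r + 1) (hF : ∀ y ∈ F, G.Adj a y)
    (hFl : F.length = m - (r + 2)) (hnd : (a :: l ++ F).Nodup)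
    (hmem : ∀ x ∈ a :: l ++ F, x ∈ Bᶜ) {w : V} (hw : w ∉ B) : w ∈ a :: l ++ F := by
  by_contra hwT
  have hno {l : List V} (h : IsEar G B l) := not_hasBroom_of_isEar hB hmax h
  set R := Bᶜ.filter fun x => 1 < (G.neighborFinset x ∩ B).card with hR
  have hear : ∀ x ∈ R, IsEar G B [x] := by
    intro x hx
    obtain ⟨hxB, hx2⟩ := Finset.mem_filter.1 hx
    obtain ⟨b₁, h₁, b₂, h₂, hne⟩ := Finset.one_lt_card.1 hx2
    simp only [Finset.mem_inter, SimpleGraph.mem_neighborFinset] at h₁ h₂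
    exact isEar_singleton (Finset.mem_compl.1 hxB) h₁.2 h₂.2 hne h₁.1.symm h₂.1.symm
  have hpoor : ∀ v ∉ B, v ∉ R → (G.neighborFinset v ∩ B).card ≤ 1 := by
    intro v hv hvR
    by_contra hlt
    exact hvR (Finset.mem_filter.2 ⟨Finset.mem_compl.2 hv, not_le.1 hlt⟩)
  have hdR : ∀ v ∈ Bᶜ, v ∉ R → m + 1 ≤ (G.neighborFinset v ∩ Bᶜ).card := by
    intro v hv hvR
    have h1 := degree_le_card_inter_add (G := G) B ∅ v
    have h2 := hdeg v
    have h3 := hpoor v (Finset.mem_compl.1 hv) hvR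
    simp only [Finset.inter_empty, Finset.card_empty, Finset.sdiff_empty] at h1
    omega
  have hRT : ∀ x ∈ R, x ∈ a :: l ++ F := by
    intro x hx
    by_contra hxT
    refine hno (hear x hx) ⟨a, l, F, hc, hl, hF, hFl, hnd, fun y hy => ?_⟩
    refine Finset.mem_sdiff.2 ⟨hmem y hy, ?_⟩
    simpa using fun e : y = x => hxT (e ▸ hy)
  have hRe : R = ∅ := by
    refine eq_empty_of_forall_path (G := G) (r := r) (W := Bᶜ) ?_ ?_ ?_
    · intro q hq hqR
      have := hdR q hq hqR
      omega
    · intro q p hqR hp hpath x hx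
      by_contra hxp
      refine hno (hear x hx) (hasBroom_of_path (l := p) hrm ⟨hpath.chain, hpath.nodup, ?_⟩ hp.ge ?_)
      · intro y hy
        refine Finset.mem_sdiff.2 ⟨hpath.mem y hy, ?_⟩
        simpa using fun e : y = x => hxp (e ▸ hy)
      -- At most one neighbour of `q` lies in `B` and at most one is `x`, so at least `m` remain.
      · have hqB := hpath.mem q (by simp)
        have h1 := degree_le_card_inter_add (G := G) B [x].toFinset q
        have h2 := hdeg q
        have h3 := hpoor q (Finset.mem_compl.1 hqB) hqR
        have h4 : (G.neighborFinset q ∩ [x].toFinset).card ≤ 1 :=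
          (Finset.card_le_card Finset.inter_subset_right).trans (by simp)
        omega
    · obtain ⟨q, p, hq, hp, hpath⟩ := exists_path_of_broom hrm hc hl hF hnd hmem
        ⟨w, Finset.mem_compl.2 hw, hwT⟩ fun v hv hvT => hdR v hv fun h => hvT (hRT v h)
      exact ⟨q, p, fun h => hq (hRT q h), hp, hpath⟩
  obtain ⟨l', hl', hbr⟩ := exists_isEar_hasBroom hG hrm hdeg hB.two_le_card ⟨w, hw⟩
    fun v hv => hpoor v hv (by simp [hRe])
  exact hno hl' hbr

/-- A broom has at most `m` vertices and all degrees exceed `m`, so every vertex has a neighbour off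
the broom; two such choices give an edge off it. -/
lemma exists_isBiconnectedSet_hasBroom [Nonempty V] (hrm : r + 3 ≤ m)
    (hdeg : ∀ v, m + 2 ≤ G.degree v) :
    ∃ B, IsBiconnectedSet G B ∧ HasBroom G r m Bᶜ := by
  have hd : ∀ u ∈ (Finset.univ : Finset V), m + 2 ≤ (G.neighborFinset u ∩ Finset.univ).card := by
    intro u _
    simpa using hdeg u
  obtain ⟨u⟩ := ‹Nonempty V›
  obtain ⟨p, hp, hpl⟩ := exists_path_of_le_degree hd (Finset.mem_univ u)
  obtain ⟨q, p', hqp⟩ : ∃ q p', p ++ [u] = q :: p' := List.exists_cons_of_ne_nil (by simp)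
  have hp'l : p'.length = m + 2 := by
    have := congrArg List.length hqp
    simp only [List.length_append, List.length_cons, List.length_nil] at this
    omega
  rw [hqp] at hp
  obtain ⟨a, l, F, hc, hl, hF, hFl, hnd, -⟩ :=
    hasBroom_of_path hrm hp (by omega) (by have := hd q (Finset.mem_univ q); omega)
  have hT : (a :: l ++ F).toFinset.card ≤ m :=
    (List.toFinset_card_le _).trans (by simp only [List.length_append, List.length_cons]; omega)
  have hout : ∀ v, ∃ y, G.Adj v y ∧ y ∉ a :: l ++ F := by
    intro v
    obtain ⟨y, hy, hyT⟩ := Finset.exists_mem_notMem_of_card_lt_card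
      (lt_of_le_of_lt hT (by
        rw [SimpleGraph.card_neighborFinset_eq_degree]
        have := hdeg v
        omega : m < (G.neighborFinset v).card))
    exact ⟨y, by simpa using hy, by simpa only [List.mem_toFinset] using hyT⟩
  obtain ⟨x, -, hx⟩ := hout u
  obtain ⟨y, hxy, hy⟩ := hout x
  refine ⟨{x, y}, IsBiconnectedSet.pair hxy, a, l, F, hc, hl, hF, hFl, hnd, fun z hz => ?_⟩
  simp only [Finset.mem_compl, Finset.mem_insert, Finset.mem_singleton, not_or]
  exact ⟨fun e => hx (e ▸ hz), fun e => hy (e ▸ hz)⟩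

end Maximal

/-- A `2`-connected graph of minimum degree at least `m + 2` has a path-star of order `m` whose
removal keeps it `2`-connected. -/
lemma exists_pathStar_connectivity_keeping {V : Type*} [Fintype V] (G : SimpleGraph V)
    [DecidableRel G.Adj] {r m : ℕ} (hrm : r + 3 ≤ m) (hG : IsVertexConnected 2 G)
    (hdeg : m + 2 ≤ G.minDegree) :
    ∃ T : G.Subgraph, Nonempty (pathStar r (m - r) ≃g T.coe) ∧
      IsVertexConnected 2 (G.induce T.vertsᶜ) := by
  classical
  have hd : ∀ v, m + 2 ≤ G.degree v := fun v => hdeg.trans (G.minDegree_le_degree v)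
  have hV : Nonempty V := by
    obtain ⟨x⟩ := (hG.2 ∅ (by simp)).nonempty
    exact ⟨x.1⟩
  obtain ⟨B₀, hB₀⟩ := exists_isBiconnectedSet_hasBroom (r := r) hrm hd
  obtain ⟨B, hB, hmax⟩ := Finset.exists_max_image
    (Finset.univ.filter fun B => IsBiconnectedSet G B ∧ HasBroom G r m Bᶜ) Finset.card
    ⟨B₀, by simpa using hB₀⟩
  simp only [Finset.mem_filter, Finset.mem_univ, true_and] at hB hmax
  obtain ⟨hBc, a, l, F, hc, hl, hF, hFl, hnd, hmem⟩ := hB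
  have hall : ∀ x, x ∉ B ↔ x ∈ a :: l ++ F := fun x =>
    ⟨fun hx => mem_broom_of_maximal hG hrm hd hBc (fun B' h₁ h₂ => hmax B' ⟨h₁, h₂⟩)
      hc hl hF hFl hnd hmem hx, fun hx => Finset.mem_compl.1 (hmem x hx)⟩
  obtain ⟨T, hT, hverts⟩ := exists_subgraph_iso_pathStar hrm hc hl hF hFl hnd
  refine ⟨T, hT, hBc.isVertexConnected ?_ ⟨a, (hall a).2 (by simp)⟩ fun x => ?_⟩
  -- The graph has at least `m + 3` vertices and the broom at most `m`, so `B` has at least three.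
  · have h1 : Bᶜ.card ≤ m := by
      have : Bᶜ = (a :: l ++ F).toFinset := by
        ext x
        rw [Finset.mem_compl, hall, List.mem_toFinset]
      rw [this]
      refine (List.toFinset_card_le _).trans ?_
      simp only [List.length_append, List.length_cons]
      omega
    have h2 := Finset.card_compl_add_card B
    have h3 := G.degree_lt_card_verts a
    have h4 := hd a
    omega
  · rw [Set.mem_compl_iff, hverts, ← hall, not_not]

end PathStarKeeping

theorem theorem3p3 {V : Type*} [Fintype V] (G : SimpleGraph V) [DecidableRel G.Adj]
    (r m : ℕ) (hr : 1 ≤ r) (hrm : r + 3 ≤ m)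
    (hG : PathStarKeeping.IsVertexConnected 2 G) (hdeg : m + 2 ≤ G.minDegree) :
    ∃ T : G.Subgraph,
      Nonempty (PathStarKeeping.pathStar r (m - r) ≃g T.coe) ∧
        PathStarKeeping.IsVertexConnected 2 (G.induce T.vertsᶜ) :=
  PathStarKeeping.exists_pathStar_connectivity_keeping G hrm hG hdeg
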